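/- For a Tychonoff space $X$ let $C_p(X)$ be the space of all real-valued continuous functions on $X$ with the topology of pointwise convergence. Let $[1,\omega]$ be the compact space of all ordinals $\gamma$ with $1\le\gamma\le\omega$, with the order topology, let $\mathbb N$ be the infinite countable discrete space, and let $\varphi$ be the $\aleph_0$-dimensional real vector space with the finest locally convex topology. The strong dual $F'_\beta$ of a locally convex space $F$ is its continuous dual with the topology of uniform convergence on the bounded subsets of $F$. Theorem. Let $X$ be a Tychonoff space. The following assertions are equivalent: (1) There is a vector subspace $F$ of $C_p(X)$, endowed with the topology induced from $C_p(X)$, that is complemented in $C_p(X)$ (i.e. $F$ is the range of a continuous linear projection of $C_p(X)$) and whose strong dual $F'_\beta$ is linearly homeomorphic to $\varphi$. (2) $C_p([1,\omega])$ or $C_p(\mathbb N)$ is a continuous linear image of $C_p(X)$; that is, there is a continuous linear surjection of $C_p(X)$ onto at least one of these two spaces. -/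

import Mathlib

/-- `Cp X`: the space of real-valued continuous functions on `X`, with the topology of pointwise
convergence, that is, the topology induced from the product `ℝ^X`. It is a type of its own because
Mathlib's topology on `C(X, ℝ)` is the compact-open one. -/
def Cp (X : Type*) [TopologicalSpace X] : Type _ := C(X, ℝ)

noncomputable section

instance (X : Type*) [TopologicalSpace X] : FunLike (Cp X) X ℝ :=
  inferInstanceAs (FunLike C(X, ℝ) X ℝ)

instance (X : Type*) [TopologicalSpace X] : AddCommGroup (Cp X) :=
  inferInstanceAs (AddCommGroup C(X, ℝ))

instance (X : Type*) [TopologicalSpace X] : Module ℝ (Cp X) :=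
  inferInstanceAs (Module ℝ C(X, ℝ))

instance (X : Type*) [TopologicalSpace X] : TopologicalSpace (Cp X) :=
  TopologicalSpace.induced (fun (f : Cp X) (x : X) => f x) Pi.topologicalSpace

/-- The inclusion of `Cp X` in `ℝ^X` as a linear map. -/
def Cp.toPi (X : Type*) [TopologicalSpace X] : Cp X →ₗ[ℝ] (X → ℝ) where
  toFun f x := f x
  map_add' _ _ := rfl
  map_smul' _ _ := rfl

instance (X : Type*) [TopologicalSpace X] : IsTopologicalAddGroup (Cp X) :=
  topologicalAddGroup_induced (Cp.toPi X)

instance (X : Type*) [TopologicalSpace X] : ContinuousSMul ℝ (Cp X) :=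
  continuousSMul_induced (Cp.toPi X)

instance (X : Type*) [TopologicalSpace X] : LocallyConvexSpace ℝ (Cp X) :=
  LocallyConvexSpace.induced (Cp.toPi X)

end

/-- The finest locally convex vector topology on a real vector space `E`
(in Mathlib's order on topologies, finer means smaller). Its basic neighbourhoods of zero are
computed in `finestLocallyConvexTopology_nhds_zero_hasBasis`. -/
@[reducible] def finestLocallyConvexTopology (E : Type*) [AddCommGroup E] [Module ℝ E] : TopologicalSpace E :=
  sInf {t : TopologicalSpace E | IsTopologicalAddGroup E ∧ ContinuousSMul ℝ E ∧
    LocallyConvexSpace ℝ E}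

/-- The finest locally convex topology is itself a locally convex vector topology. -/
theorem finestLocallyConvexTopology_isLocallyConvex
    (E : Type*) [AddCommGroup E] [Module ℝ E] :
    finestLocallyConvexTopology E ∈ {t : TopologicalSpace E | IsTopologicalAddGroup E ∧
      ContinuousSMul ℝ E ∧ LocallyConvexSpace ℝ E} :=
  ⟨topologicalAddGroup_sInf fun _ ht => ht.1, continuousSMul_sInf fun _ ht => ht.2.1,
    LocallyConvexSpace.sInf fun _ ht => ht.2.2⟩

/-- In the finest locally convex topology, all absolutely convex absorbing sets
form a base of neighbourhoods of zero. -/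
theorem finestLocallyConvexTopology_nhds_zero_hasBasis
    (E : Type*) [AddCommGroup E] [Module ℝ E] :
    (@nhds E (finestLocallyConvexTopology E) 0).HasBasis
      (fun V : Set E => AbsConvex ℝ V ∧ Absorbent ℝ V) id := by
  have key : ∀ V : Set E, AbsConvex ℝ V → Absorbent ℝ V →
      V ∈ @nhds E (finestLocallyConvexTopology E) 0 := by
    intro V hV hV'
    let q : Seminorm ℝ E := gaugeSeminorm hV.1 hV.2 hV'
    let p : SeminormFamily ℝ E Unit := fun _ => q
    let t : TopologicalSpace E := p.moduleFilterBasis.topology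
    have hp : WithSeminorms p := ⟨rfl⟩
    have ht : finestLocallyConvexTopology E ≤ t :=
      sInf_le ⟨hp.topologicalAddGroup, hp.continuousSMul, hp.toLocallyConvexSpace⟩
    refine nhds_mono ht ?_
    have hb : q.ball 0 1 ∈ @nhds E t 0 :=
      hp.hasBasis_zero_ball.mem_iff.2 ⟨({()}, 1), one_pos, by simp [p]⟩
    refine Filter.mem_of_superset hb fun x hx => ?_
    rw [Seminorm.mem_ball_zero] at hx
    exact setOfPred_gauge_lt_one_subset_self hV.2 hV'.zero_mem hV' hx
  let _ := finestLocallyConvexTopology E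
  obtain ⟨h1, h2, h3⟩ := finestLocallyConvexTopology_isLocallyConvex E
  refine (nhds_hasBasis_absConvex ℝ E).to_hasBasis ?_ ?_
  · exact fun V hV => ⟨V, ⟨hV.2, absorbent_nhds_zero hV.1⟩, subset_rfl⟩
  · exact fun V hV => ⟨V, ⟨key V hV.1 hV.2, hV.1⟩, subset_rfl⟩

/-- `φ`: the real vector space of dimension `ℵ₀`, realized as the finitely supported sequences,
to be endowed with the finest locally convex topology. -/
def PhiSpace : Type := ℕ →₀ ℝ

noncomputable instance : AddCommGroup PhiSpace := inferInstanceAs (AddCommGroup (ℕ →₀ ℝ))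

noncomputable instance : Module ℝ PhiSpace := inferInstanceAs (Module ℝ (ℕ →₀ ℝ))

noncomputable instance : TopologicalSpace PhiSpace := finestLocallyConvexTopology PhiSpace

/-- A subspace `F` is `φ`-dual if its strong dual is linearly homeomorphic to `φ`.
Here `F` has the subspace topology, and the topology that Mathlib puts on `F →L[ℝ] ℝ` is that of
uniform convergence on the (von Neumann) bounded subsets of `F`, i.e. the strong topology. -/
def IsPhiDual {E : Type*} [AddCommGroup E] [Module ℝ E] [TopologicalSpace E]
    (F : Submodule ℝ E) : Prop :=
  Nonempty ((F →L[ℝ] ℝ) ≃L[ℝ] PhiSpace)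

/-- `F` is a continuous linear image of `E`. -/
def IsContinuousLinearImage (F E : Type*) [AddCommGroup E] [Module ℝ E] [TopologicalSpace E]
    [AddCommGroup F] [Module ℝ F] [TopologicalSpace F] : Prop :=
  ∃ T : E →L[ℝ] F, Function.Surjective T

/-!
The two assertions are compared through disjoint systems: sequences `f k` of pairwise disjointly
supported continuous functions on `X` together with biorthogonal functionals `ν k` on `Cp X`. If
`∑ᶠ k, ν k g • f k` is continuous for every `g`, it defines a continuous linear projection of
`Cp X`, because at each point it has at most one term. The topology of its range `F` is the one of
coordinatewise convergence, and then `F` has strong dual `φ`: the dual is spanned by the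
coordinates, and already the polars of the boxes in `F` are arbitrarily small
(`DisjointSystem.exists_closedComplemented_isPhiDual`, `nonempty_dual_equiv_phiSpace`).

If `X` is not pseudocompact, bumps along an unbounded function form a disjoint system for which
all coefficient sequences are allowed, so both assertions hold. If `X` is pseudocompact, `Cp ℕ` is
not a continuous linear image of `Cp X`, and each assertion is equivalent to the existence of a
Josefson–Nissenzweig sequence: finitely supported signed measures `μ n` of norm one with
`μ n g → 0` for all continuous `g`.

* From such a sequence, `IsJNSequence.exists_disjointSystem` constructs a bounded disjoint system
  whose coordinates tend to zero at every `g`. The series along it with null coefficients converge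
  uniformly, so both assertions follow, `Cp [1, ω]` being the space of null sequences. The
  functions are chosen inductively: along an ultrafilter the measures put little mass on some
  neighbourhood of a set which carries a quarter of the mass of a suitable later measure. This
  makes the matrix `μ (n j) (f k)` lower triangular with small entries off the diagonal, and the
  coordinates come from Gaussian elimination.
* A surjection onto the null sequences consists of functionals which do not tend to zero in norm,
  and a subsequence of these can be normalized (`exists_isJNSequence_of_surjective`).
* If `F` is complemented with strong dual `φ`, then countably many members of `F` separate its
  dual. Hence `F` lives on a compact metrizable quotient of `X` and is separable for the supremum
  norm. Functionals of norm one vanishing on more and more members of a dense sequence tend to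
  zero pointwise (`exists_isJNSequence_of_isPhiDual`).
-/

open Filter Topology

section

/-! ### The space of continuous functions and its dual -/

namespace Cp

variable {X Y : Type*} [TopologicalSpace X] [TopologicalSpace Y]

/-- A continuous function, as an element of `Cp X`. -/
def mk (f : X → ℝ) (hf : Continuous f) : Cp X := (⟨f, hf⟩ : C(X, ℝ))

@[simp] lemma mk_apply (f : X → ℝ) (hf : Continuous f) (x : X) : mk f hf x = f x := rfl

@[simp] lemma add_apply (f g : Cp X) (x : X) : (f + g) x = f x + g x := rfl

@[simp] lemma smul_apply (c : ℝ) (f : Cp X) (x : X) : (c • f) x = c * f x := rfl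

protected lemma continuous (f : Cp X) : Continuous f := (show C(X, ℝ) from f).continuous

lemma isInducing_coe : IsInducing (fun (f : Cp X) (x : X) => f x) := ⟨rfl⟩

lemma continuous_rng_iff {g : Y → Cp X} : Continuous g ↔ ∀ x, Continuous fun y => g y x := by
  rw [isInducing_coe.continuous_iff, continuous_pi_iff]
  rfl

/-- Evaluation at a point, as a continuous linear functional on `Cp X`. -/
def eval (x : X) : Cp X →L[ℝ] ℝ where
  toFun f := f x
  map_add' _ _ := rfl
  map_smul' _ _ := rfl
  cont := continuous_rng_iff.1 continuous_id x

@[simp] lemma eval_apply (x : X) (f : Cp X) : eval x f = f x := rfl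

/-- The dual of `Cp X` is spanned by the evaluations: a continuous linear functional on `Cp X` is
integration against a finitely supported signed measure. -/
lemma exists_finsupp (L : Cp X →L[ℝ] ℝ) :
    ∃ μ : X →₀ ℝ, ∀ f : Cp X, L f = μ.sum fun x a => a * f x := by
  have h : (L : Cp X →ₗ[ℝ] ℝ) ∈
      Submodule.span ℝ (Set.range fun x : X => (eval x : Cp X →ₗ[ℝ] ℝ)) := by
    rw [LinearMap.mem_span_iff_continuous, ← induced_to_pi]
    exact L.continuous
  obtain ⟨μ, hμ⟩ := (Finsupp.mem_span_range_iff_exists_finsupp).1 h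
  refine ⟨μ, fun f => ?_⟩
  have := LinearMap.congr_fun hμ f
  rw [Finsupp.sum, LinearMap.sum_apply] at this
  exact this.symm

/-- Integration against a finitely supported signed measure. -/
def integral (μ : X →₀ ℝ) : Cp X →L[ℝ] ℝ := ∑ x ∈ μ.support, μ x • eval x

lemma integral_apply (μ : X →₀ ℝ) (f : Cp X) : integral μ f = μ.sum fun x a => a * f x := by
  simp [integral, Finsupp.sum, sum_apply]

end Cp

/-! ### Spaces whose strong dual is `φ` -/

section PhiDual

variable {F : Type*} [AddCommGroup F] [Module ℝ F] [TopologicalSpace F]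

/-- Every linear map from `φ` to a locally convex space is continuous. -/
lemma PhiSpace.continuous_linearMap {G : Type*} [AddCommGroup G] [Module ℝ G] [TopologicalSpace G]
    [IsTopologicalAddGroup G] [ContinuousSMul ℝ G] [LocallyConvexSpace ℝ G]
    (T : PhiSpace →ₗ[ℝ] G) : Continuous T := by
  rw [continuous_iff_le_induced]
  exact sInf_le ⟨topologicalAddGroup_induced T, continuousSMul_induced T,
    LocallyConvexSpace.induced T⟩

/-- A locally convex space whose topology is induced by a sequence of functionals `c k` which is
biorthogonal to some sequence `e k` has strong dual `φ`. The dual is spanned by the `c k`, and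
the boxes `{f | ∀ k, |c k f| ≤ r k}` are bounded sets whose polars are as small as desired. -/
lemma nonempty_dual_equiv_phiSpace [IsTopologicalAddGroup F] [ContinuousSMul ℝ F]
    (c : ℕ → F →L[ℝ] ℝ) (e : ℕ → F) (hce : ∀ j k, c j (e k) = if j = k then 1 else 0)
    (hc : IsInducing fun (f : F) (k : ℕ) => c k f) :
    Nonempty ((F →L[ℝ] ℝ) ≃L[ℝ] PhiSpace) := by
  let Ψ : (ℕ →₀ ℝ) →ₗ[ℝ] (F →L[ℝ] ℝ) := Finsupp.linearCombination ℝ c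
  have hΨ : ∀ a k, Ψ a (e k) = a k := by
    intro a k
    simp only [Ψ, Finsupp.linearCombination_apply, Finsupp.sum, sum_apply,
      smul_apply, hce, smul_eq_mul, mul_ite, mul_one, mul_zero,
      Finset.sum_ite_eq', Finsupp.mem_support_iff]
    split_ifs with h
    · rfl
    · exact (not_not.1 h).symm
  have hinj : Function.Injective Ψ := by
    intro a b hab
    ext k
    rw [← hΨ, hab, hΨ]
  have hsurj : Function.Surjective Ψ := by
    intro L
    have h : (L : F →ₗ[ℝ] ℝ) ∈
        Submodule.span ℝ (Set.range fun k => (c k : F →ₗ[ℝ] ℝ)) := by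
      rw [LinearMap.mem_span_iff_continuous, ← induced_to_pi]
      exact continuous_le_dom hc.eq_induced.ge L.continuous
    obtain ⟨a, ha⟩ := (Finsupp.mem_span_range_iff_exists_finsupp).1 h
    refine ⟨a, ?_⟩
    ext f
    have := LinearMap.congr_fun ha f
    rw [Finsupp.sum, LinearMap.sum_apply] at this
    simpa [Ψ, Finsupp.linearCombination_apply, Finsupp.sum] using this
  let Θ : PhiSpace ≃ₗ[ℝ] (F →L[ℝ] ℝ) := LinearEquiv.ofBijective Ψ ⟨hinj, hsurj⟩
  have hΘe : ∀ (a : PhiSpace) k, Θ a (e k) = (show ℕ →₀ ℝ from a) k := hΨ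
  have hΘ : Continuous Θ := PhiSpace.continuous_linearMap Θ.toLinearMap
  have hΘ' : Continuous Θ.symm := by
    have : IsTopologicalAddGroup PhiSpace :=
      (finestLocallyConvexTopology_isLocallyConvex PhiSpace).1
    refine continuous_of_continuousAt_zero Θ.symm ?_
    rw [ContinuousAt, map_zero,
      (finestLocallyConvexTopology_nhds_zero_hasBasis PhiSpace).tendsto_right_iff]
    intro V hV
    let q : Seminorm ℝ PhiSpace := gaugeSeminorm hV.1.1 hV.1.2 hV.2
    let δ : ℕ → PhiSpace := fun k => (Finsupp.single k (1 : ℝ) : ℕ →₀ ℝ)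
    -- the polar of this box lies in `V`, since it consists of `a` with `∑ |a k| * q (δ k) ≤ 1 / 2`
    let B : Set F := {f | ∀ k, |c k f| ≤ 2 * q (δ k)}
    have hB : Bornology.IsVonNBounded ℝ B := by
      have h1 : Bornology.IsVonNBounded ℝ
          (Set.pi Set.univ fun k => Metric.closedBall (0 : ℝ) (2 * q (δ k))) := by
        rw [Bornology.isVonNBounded_pi_iff]
        intro k
        refine (NormedSpace.isVonNBounded_closedBall ℝ ℝ (2 * q (δ k))).subset ?_
        rintro _ ⟨y, hy, rfl⟩
        exact hy k (Set.mem_univ k)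
      intro U hU
      rw [hc.nhds_eq_comap] at hU
      obtain ⟨W, hW, hWU⟩ := hU
      have h0 : (fun k => c k (0 : F)) = 0 := by ext k; simp
      rw [h0] at hW
      have h2 := h1 hW
      rw [absorbs_iff_eventually_cobounded_mapsTo] at h2 ⊢
      filter_upwards [h2] with r hr f hf
      refine hWU ?_
      have := hr (x := fun k => c k f) (fun k _ => by simpa using hf k)
      simpa [Pi.smul_def] using this
    have hev := ContinuousLinearMap.eventually_nhds_zero_mapsTo (σ := RingHom.id ℝ) (F := ℝ)
      hB (Metric.closedBall_mem_nhds (0 : ℝ) one_pos)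
    filter_upwards [hev] with L hL
    set a := Θ.symm L with ha
    have hLa : L = Θ a := by simp [ha]
    let s : Finset ℕ := (show ℕ →₀ ℝ from a).support
    let α : ℕ → ℝ := fun k => (show ℕ →₀ ℝ from a) k
    have hsum : a = ∑ k ∈ s, α k • δ k := by
      have : ∀ b : ℕ →₀ ℝ, b = ∑ k ∈ b.support, b k • Finsupp.single k (1 : ℝ) := by
        intro b
        conv_lhs => rw [← Finsupp.sum_single b]
        simp [Finsupp.sum]
      exact this a
    have hq : q a ≤ ∑ k ∈ s, |α k| * q (δ k) := by
      conv_lhs => rw [hsum]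
      refine (Finset.le_sum_of_subadditive q (map_zero q).le (map_add_le_add q) s _).trans ?_
      simp [map_smul_eq_mul]
    let f : F := ∑ k ∈ s, (SignType.sign (α k) * (2 * q (δ k)) : ℝ) • e k
    have hsgn : ∀ t : ℝ, |(SignType.sign t : ℝ)| ≤ 1 := by
      intro t
      rcases lt_trichotomy t 0 with h | h | h <;> simp [h]
    have hf : f ∈ B := by
      intro j
      have hq0 : 0 ≤ 2 * q (δ j) := by positivity
      simp only [f, map_sum, map_smul, hce, smul_eq_mul, mul_ite, mul_one, mul_zero,
        Finset.sum_ite_eq]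
      split_ifs
      · rw [abs_mul, abs_of_nonneg hq0]
        exact mul_le_of_le_one_left hq0 (hsgn _)
      · simp [hq0]
    have h3 : |L f| ≤ 1 := by simpa using hL hf
    have h4 : L f = 2 * ∑ k ∈ s, |α k| * q (δ k) := by
      simp only [f, map_sum, map_smul, smul_eq_mul, hLa, Finset.mul_sum]
      refine Finset.sum_congr rfl fun k _ => ?_
      rw [hΘe]
      have := sign_mul_self (α k)
      change _ * _ * α k = _
      rw [← this]
      ring
    have h5 : q a < 1 := by
      have := (le_abs_self _).trans h3
      rw [h4] at this
      linarith
    exact setOfPred_gauge_lt_one_subset_self hV.1.2 hV.2.zero_mem hV.2 h5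
  exact ⟨{ Θ.symm with
    continuous_toFun := hΘ'
    continuous_invFun := hΘ }⟩

end PhiDual

/-! ### Disjoint systems -/

section DisjointSystem

variable {X : Type*} [TopologicalSpace X]

/-- A biorthogonal system in `Cp X` whose vectors are pairwise disjointly supported functions. -/
structure DisjointSystem (X : Type*) [TopologicalSpace X] where
  /-- the vectors of the system -/
  vec : ℕ → Cp X
  /-- the coordinate functionals of the system -/
  coord : ℕ → Cp X →L[ℝ] ℝ
  disjoint : ∀ j k, j ≠ k → ∀ x, vec j x = 0 ∨ vec k x = 0
  coord_vec : ∀ j k, coord j (vec k) = if j = k then 1 else 0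

namespace DisjointSystem

variable (S : DisjointSystem X)

/-- At each point, a series along a disjoint system has at most one term, at an index
that does not depend on the coefficients. -/
lemma exists_finsum_eq (x : X) :
    ∃ k, ∀ a : ℕ → ℝ, ∑ᶠ j, a j * S.vec j x = a k * S.vec k x := by
  by_cases h : ∃ k, S.vec k x ≠ 0
  · obtain ⟨k, hk⟩ := h
    refine ⟨k, fun a => finsum_eq_single _ k fun j hj => ?_⟩
    rcases S.disjoint j k hj x with h | h
    · simp [h]
    · exact absurd h hk
  · push Not at h
    exact ⟨0, fun a => by simp [h]⟩

/-- A functional on `Cp X` depends on finitely many values only, so it sees only a finite part of a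
disjoint series. -/
lemma exists_finset_apply_finsum (a : ℕ → ℝ) (ha : Continuous fun x => ∑ᶠ k, a k * S.vec k x)
    (L : Cp X →L[ℝ] ℝ) (j : ℕ) :
    ∃ s : Finset ℕ, L (Cp.mk _ ha) = ∑ k ∈ s, a k * L (S.vec k) ∧ j ∈ s := by
  classical
  obtain ⟨μ, hμ⟩ := Cp.exists_finsupp L
  choose κ hκ using S.exists_finsum_eq
  have hfin : ∀ x, ∀ s : Finset ℕ, κ x ∈ s →
      ∑ᶠ k, a k * S.vec k x = ∑ k ∈ s, a k * S.vec k x := by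
    intro x s hs
    have h := hκ x (fun k => if k ∈ s then a k else 0)
    rw [hκ x a]
    simp only [hs, if_true] at h
    rw [← h, finsum_eq_sum_of_support_subset _ (s := s)]
    · exact Finset.sum_congr rfl fun k hk => by simp [hk]
    · intro k hk
      by_contra hks
      apply hk
      simp [show k ∉ s from hks]
  refine ⟨insert j (μ.support.image κ), ?_, Finset.mem_insert_self _ _⟩
  rw [hμ]
  simp only [hμ, Finsupp.sum, Cp.mk_apply, Finset.mul_sum]
  rw [Finset.sum_comm]
  refine Finset.sum_congr rfl fun x hx => ?_
  rw [hfin x (insert j (μ.support.image κ))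
    (Finset.mem_insert_of_mem (Finset.mem_image_of_mem _ hx)), Finset.mul_sum]
  exact Finset.sum_congr rfl fun k _ => by ring

lemma coord_finsum (a : ℕ → ℝ) (ha : Continuous fun x => ∑ᶠ k, a k * S.vec k x) (j : ℕ) :
    S.coord j (Cp.mk _ ha) = a j := by
  obtain ⟨s, hs, hj⟩ := S.exists_finset_apply_finsum a ha (S.coord j) j
  simp [hs, S.coord_vec, hj]

/-- For coefficients tending to zero, a uniformly bounded disjoint series converges uniformly. -/
lemma continuous_finsum_of_tendsto (hS : ∀ k x, |S.vec k x| ≤ 1) {a : ℕ → ℝ}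
    (ha : Tendsto a atTop (𝓝 0)) : Continuous fun x => ∑ᶠ k, a k * S.vec k x := by
  have hunif : TendstoUniformly (fun (n : ℕ) x => ∑ k ∈ Finset.range n, a k * S.vec k x)
      (fun x => ∑ᶠ k, a k * S.vec k x) atTop := by
    rw [Metric.tendstoUniformly_iff]
    intro ε hε
    obtain ⟨N, hN⟩ := Metric.tendsto_atTop.1 ha ε hε
    filter_upwards [eventually_ge_atTop N] with n hn x
    obtain ⟨κ, hκ⟩ := S.exists_finsum_eq x
    have h1 := hκ (fun k => if k ∈ Finset.range n then a k else 0)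
    rw [finsum_eq_sum_of_support_subset _ (s := Finset.range n)] at h1
    · have h2 : ∑ k ∈ Finset.range n, a k * S.vec k x =
          (if κ ∈ Finset.range n then a κ else 0) * S.vec κ x := by
        rw [← h1]
        exact Finset.sum_congr rfl fun k hk => by simp only [hk, if_true]
      rw [h2, hκ, Real.dist_eq, ← sub_mul, abs_mul]
      split_ifs with h
      · simpa using hε
      · have h3 := hN κ (hn.trans (by simpa using h))
        rw [Real.dist_eq] at h3
        exact (mul_le_of_le_one_right (abs_nonneg _) (hS κ x)).trans_lt h3
    · intro k hk
      by_contra hks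
      apply hk
      simp only [show k ∉ Finset.range n from hks, if_false, zero_mul]
  refine hunif.continuous (Eventually.of_forall fun n => ?_).frequently
  exact continuous_finsetSum _ fun k _ => continuous_const.mul (S.vec k).continuous

/-- If every `g` has a continuous expansion `∑ᶠ k, coord k g • vec k` along a disjoint system, then
the expansion is a continuous linear projection, and its range has strong dual `φ`. -/
lemma exists_closedComplemented_isPhiDual
    (hS : ∀ g : Cp X, Continuous fun x => ∑ᶠ k, S.coord k g * S.vec k x) :
    ∃ F : Submodule ℝ (Cp X), F.ClosedComplemented ∧ IsPhiDual F := by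
  have hP : ∀ (g : Cp X) x, ∃ k, ∀ g : Cp X, Cp.mk _ (hS g) x = S.coord k g * S.vec k x := by
    intro g x
    obtain ⟨k, hk⟩ := S.exists_finsum_eq x
    exact ⟨k, fun g => hk _⟩
  let P : Cp X →ₗ[ℝ] Cp X :=
    { toFun := fun g => Cp.mk _ (hS g)
      map_add' := by
        intro g h
        refine DFunLike.ext _ _ fun x => ?_
        obtain ⟨k, hk⟩ := hP 0 x
        rw [Cp.add_apply, hk, hk, hk, map_add, add_mul]
      map_smul' := by
        intro c g
        refine DFunLike.ext _ _ fun x => ?_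
        obtain ⟨k, hk⟩ := hP 0 x
        rw [Cp.smul_apply, hk, hk, map_smul, RingHom.id_apply, smul_eq_mul, mul_assoc] }
  have hPx : ∀ x, ∃ k, ∀ g, P g x = S.coord k g * S.vec k x := hP 0
  have hPc : Continuous P := by
    rw [Cp.continuous_rng_iff]
    intro x
    obtain ⟨k, hk⟩ := hPx x
    simp only [hk]
    exact (S.coord k).continuous.mul continuous_const
  have hcoord : ∀ k g, S.coord k (P g) = S.coord k g := fun k g => S.coord_finsum _ (hS g) k
  have hPP : ∀ g, P (P g) = P g := by
    intro g
    refine DFunLike.ext _ _ fun x => ?_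
    obtain ⟨k, hk⟩ := hPx x
    rw [hk, hk, hcoord]
  have hvec : ∀ k, P (S.vec k) = S.vec k := by
    intro k
    refine DFunLike.ext _ _ fun x => ?_
    change ∑ᶠ j, S.coord j (S.vec k) * S.vec j x = _
    rw [finsum_eq_single _ k fun j hj => by simp [S.coord_vec, hj]]
    simp [S.coord_vec]
  have hfix : ∀ f : LinearMap.range P, P f = f := by
    rintro ⟨_, g, rfl⟩
    exact hPP g
  refine ⟨LinearMap.range P, ⟨⟨P.rangeRestrict, ?_⟩, ?_⟩, ?_⟩
  · exact hPc.subtype_mk _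
  · intro f
    exact Subtype.ext (hfix f)
  · choose κ hκ using hPx
    -- the values of a member of the range are multiples of its coordinates
    let Φ : (ℕ → ℝ) → X → ℝ := fun y x => y (κ x) * S.vec (κ x) x
    have hΦ : Continuous Φ :=
      continuous_pi fun x => (continuous_apply (κ x)).mul continuous_const
    let c : ℕ → LinearMap.range P →L[ℝ] ℝ :=
      fun k => (S.coord k).comp (LinearMap.range P).subtypeL
    have hc : Continuous fun (f : LinearMap.range P) (k : ℕ) => c k f :=
      continuous_pi fun k => (c k).continuous
    refine nonempty_dual_equiv_phiSpace c (fun k => ⟨S.vec k, S.vec k, hvec k⟩) S.coord_vec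
      (IsInducing.of_comp hc hΦ ?_)
    have h : (Φ ∘ fun (f : LinearMap.range P) (k : ℕ) => c k f) =
        (fun (f : Cp X) (x : X) => f x) ∘ Subtype.val := by
      funext f x
      change S.coord (κ x) f * S.vec (κ x) x = (f : Cp X) x
      rw [← hκ, hfix]
    rw [h]
    exact Cp.isInducing_coe.comp IsInducing.subtypeVal

end DisjointSystem
end DisjointSystem

/-! ### Surjections onto `Cp ℕ` and `Cp [1, ω]` -/

section Images

variable {X : Type*} [TopologicalSpace X]

lemma isContinuousLinearImage_cp_nat_iff :
    IsContinuousLinearImage (Cp ℕ) (Cp X) ↔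
      ∃ ν : ℕ → Cp X →L[ℝ] ℝ, ∀ a : ℕ → ℝ, ∃ g, ∀ n, ν n g = a n := by
  constructor
  · rintro ⟨T, hT⟩
    refine ⟨fun n => (Cp.eval n).comp T, fun a => ?_⟩
    obtain ⟨g, hg⟩ := hT (Cp.mk a continuous_of_discreteTopology)
    exact ⟨g, fun n => by simp [hg]⟩
  · rintro ⟨ν, hν⟩
    refine ⟨⟨{ toFun := fun g => Cp.mk (fun n => ν n g) continuous_of_discreteTopology
               map_add' := fun g h => DFunLike.ext _ _ fun n => by simp
               map_smul' := fun c g => DFunLike.ext _ _ fun n => by simp }, ?_⟩, fun h => ?_⟩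
    · exact Cp.continuous_rng_iff.2 fun n => (ν n).continuous
    · obtain ⟨g, hg⟩ := hν h
      exact ⟨g, DFunLike.ext _ _ hg⟩

/-- The interval `[1, ω]` of ordinals. -/
abbrev OmegaIcc : Type 1 := Set.Icc (1 : Ordinal.{0}) Ordinal.omega0

namespace OmegaIcc

/-- The point `ω` of `[1, ω]`. -/
def omega : OmegaIcc := ⟨Ordinal.omega0, Ordinal.one_lt_omega0.le, le_rfl⟩

/-- The isolated points `1, 2, …` of `[1, ω]`, numbered from `0`. -/
def succ (n : ℕ) : OmegaIcc :=
  ⟨((n + 1 : ℕ) : Ordinal), by exact_mod_cast Nat.succ_pos n, (Ordinal.natCast_lt_omega0 _).le⟩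

lemma succ_ne_omega (n : ℕ) : succ n ≠ omega :=
  fun h => (Ordinal.natCast_lt_omega0 (n + 1)).ne (congrArg Subtype.val h)

lemma succ_injective : Function.Injective succ := by
  intro m n h
  have : ((m + 1 : ℕ) : Ordinal) = ((n + 1 : ℕ) : Ordinal) := congrArg Subtype.val h
  have := Nat.cast_injective this
  omega

lemma eq_succ_or_eq_omega (γ : OmegaIcc) : (∃ n, γ = succ n) ∨ γ = omega := by
  obtain ⟨γ, h1, h2⟩ := γ
  rcases h2.lt_or_eq with h | h
  · obtain ⟨n, rfl⟩ := Ordinal.lt_omega0.1 h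
    have hn : 1 ≤ n := by exact_mod_cast h1
    refine Or.inl ⟨n - 1, Subtype.ext ?_⟩
    simp [succ, Nat.sub_add_cancel hn]
  · exact Or.inr (Subtype.ext h)

lemma tendsto_succ : Tendsto succ atTop (𝓝 omega) := by
  rw [tendsto_subtype_rng, tendsto_order]
  constructor
  · intro a ha
    obtain ⟨m, rfl⟩ := Ordinal.lt_omega0.1 ha
    filter_upwards [eventually_ge_atTop m] with n hn
    change (m : Ordinal) < ((n + 1 : ℕ) : Ordinal)
    exact_mod_cast Nat.lt_succ_of_le hn
  · intro a ha
    exact Eventually.of_forall fun n => (Ordinal.natCast_lt_omega0 _).trans ha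

/-- A function on `[1, ω]` is continuous as soon as it is sequentially continuous at `ω`. -/
lemma continuous_of_tendsto {h : OmegaIcc → ℝ}
    (hh : Tendsto (fun n => h (succ n)) atTop (𝓝 (h omega))) : Continuous h := by
  rw [continuous_iff_continuousAt]
  intro γ
  rcases eq_succ_or_eq_omega γ with ⟨n, rfl⟩ | rfl
  · have h1 : IsOpen ({((n + 1 : ℕ) : Ordinal)} : Set Ordinal) :=
      SuccOrder.isOpen_singleton_iff.2 fun hlim =>
        (Ordinal.natCast_lt_of_isSuccLimit hlim (n + 1)).false
    have h2 : ∀ᶠ γ in 𝓝 (succ n), γ = succ n :=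
      mem_of_superset ((h1.preimage continuous_subtype_val).mem_nhds rfl)
        fun γ hγ => Subtype.ext hγ
    exact tendsto_const_nhds.congr' (h2.mono fun γ hγ => by rw [hγ])
  · intro U hU
    obtain ⟨N, hN⟩ := eventually_atTop.1 (hh hU)
    have h1 : {γ : OmegaIcc | ((N : ℕ) : Ordinal) < γ.1} ∈ 𝓝 omega :=
      (isOpen_Ioi.preimage continuous_subtype_val).mem_nhds (Ordinal.natCast_lt_omega0 N)
    refine Filter.mem_map.2 (mem_of_superset h1 fun γ hγ => ?_)
    rcases eq_succ_or_eq_omega γ with ⟨n, rfl⟩ | rfl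
    · have : N < n + 1 := by
        exact_mod_cast (show ((N : ℕ) : Ordinal) < ((n + 1 : ℕ) : Ordinal) from hγ)
      exact hN n (by omega)
    · exact mem_of_mem_nhds (x := h omega) hU

open Classical in
/-- The function on `[1, ω]` with given values. -/
noncomputable def ofSeq (b : ℕ → ℝ) (l : ℝ) (γ : OmegaIcc) : ℝ :=
  if h : ∃ n, γ = succ n then b h.choose else l

@[simp] lemma ofSeq_succ (b : ℕ → ℝ) (l : ℝ) (n : ℕ) : ofSeq b l (succ n) = b n := by
  have h : ∃ m, succ n = succ m := ⟨n, rfl⟩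
  rw [ofSeq, dif_pos h, ← succ_injective h.choose_spec]

@[simp] lemma ofSeq_omega (b : ℕ → ℝ) (l : ℝ) : ofSeq b l omega = l :=
  dif_neg fun ⟨n, h⟩ => succ_ne_omega n h.symm

lemma continuous_ofSeq {b : ℕ → ℝ} {l : ℝ} (h : Tendsto b atTop (𝓝 l)) :
    Continuous (ofSeq b l) :=
  continuous_of_tendsto (by simpa using h)

lemma cp_ext {f g : Cp OmegaIcc} (h : ∀ n, f (succ n) = g (succ n)) (h' : f omega = g omega) :
    f = g := by
  refine DFunLike.ext _ _ fun γ => ?_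
  rcases eq_succ_or_eq_omega γ with ⟨n, rfl⟩ | rfl
  exacts [h n, h']

end OmegaIcc

/-- `Cp [1, ω]` is isomorphic to the space of null sequences with the topology of coordinatewise
convergence. -/
lemma isContinuousLinearImage_cp_omegaIcc_iff :
    IsContinuousLinearImage (Cp OmegaIcc) (Cp X) ↔
      ∃ ν : ℕ → Cp X →L[ℝ] ℝ, (∀ g, Tendsto (fun n => ν n g) atTop (𝓝 0)) ∧
        ∀ a : ℕ → ℝ, Tendsto a atTop (𝓝 0) → ∃ g, ∀ n, ν n g = a n := by
  constructor
  · rintro ⟨T, hT⟩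
    refine ⟨fun n => (Cp.eval (OmegaIcc.succ n) - Cp.eval OmegaIcc.omega).comp T,
      fun g => ?_, fun a ha => ?_⟩
    · have := ((T g).continuous.tendsto OmegaIcc.omega).comp OmegaIcc.tendsto_succ
      simpa using this.sub_const (T g OmegaIcc.omega)
    · obtain ⟨g, hg⟩ := hT (Cp.mk _ (OmegaIcc.continuous_ofSeq ha))
      exact ⟨g, fun n => by simp [hg]⟩
  · rintro ⟨ν, hν, hsurj⟩
    have hc : ∀ g, Tendsto (fun n => ν 0 g + ν (n + 1) g) atTop (𝓝 (ν 0 g)) := by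
      intro g
      simpa using ((tendsto_add_atTop_iff_nat 1).2 (hν g)).const_add (ν 0 g)
    refine ⟨⟨{ toFun := fun g => Cp.mk _ (OmegaIcc.continuous_ofSeq (hc g))
               map_add' := fun g h => OmegaIcc.cp_ext (fun n => ?_) ?_
               map_smul' := fun c g => OmegaIcc.cp_ext (fun n => ?_) ?_ }, ?_⟩, fun h => ?_⟩
    · simp; ring
    · simp
    · simp; ring
    · simp
    · refine Cp.continuous_rng_iff.2 fun γ => ?_
      rcases OmegaIcc.eq_succ_or_eq_omega γ with ⟨n, rfl⟩ | rfl
      · simpa [Pi.add_def] using (ν 0).continuous.add (ν (n + 1)).continuous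
      · simpa using (ν 0).continuous
    · obtain ⟨g, hg⟩ := hsurj
        (fun n => Nat.casesOn n (h OmegaIcc.omega)
          fun m => h (OmegaIcc.succ m) - h OmegaIcc.omega) (by
        rw [← tendsto_add_atTop_iff_nat 1]
        have := (h.continuous.tendsto OmegaIcc.omega).comp OmegaIcc.tendsto_succ
        simpa using this.sub_const (h OmegaIcc.omega))
      exact ⟨g, OmegaIcc.cp_ext (fun n => by simp [hg]) (by simp [hg])⟩

end Images

/-! ### Pseudocompact spaces -/

section Pseudocompact

/-- A space is pseudocompact if all its continuous real-valued functions are bounded. -/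
def IsPseudocompact (X : Type*) [TopologicalSpace X] : Prop :=
  ∀ f : Cp X, ∃ C, ∀ x, |f x| ≤ C

variable {X : Type*} [TopologicalSpace X]

/-- If `|f|` takes values `t 0, t 1, …` that are at least `2` apart, then the bumps
`max 0 (1 - ||f| - t k|)` form a locally finite, disjointly supported family, and any series along
it is continuous. -/
lemma exists_disjointSystem_of_not_isPseudocompact (hX : ¬ IsPseudocompact X) :
    ∃ S : DisjointSystem X, ∀ a : ℕ → ℝ, Continuous fun x => ∑ᶠ k, a k * S.vec k x := by
  simp only [IsPseudocompact, not_forall, not_exists, not_le] at hX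
  obtain ⟨f, hf⟩ := hX
  choose pt hpt using hf
  let p : ℕ → X := fun k => Nat.rec (pt 0) (fun _ y => pt (|f y| + 2)) k
  let t : ℕ → ℝ := fun k => |f (p k)|
  have ht : ∀ k, t k + 2 < t (k + 1) := fun k => hpt (|f (p k)| + 2)
  have hmono : StrictMono t := strictMono_nat_of_lt_succ fun k => by linarith [ht k]
  have hsep : ∀ j k, j < k → t j + 2 ≤ t k := fun j k hjk =>
    (ht j).le.trans (hmono.monotone hjk)
  have hlarge : ∀ k : ℕ, (k : ℝ) ≤ t k := by
    intro k
    induction k with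
    | zero => exact_mod_cast abs_nonneg (f (p 0))
    | succ k ih => push_cast; linarith [ht k]
  have hcont : ∀ k, Continuous fun x => max 0 (1 - |(|f x|) - t k|) := fun k =>
    continuous_const.max (continuous_const.sub ((f.continuous.abs.sub continuous_const).abs))
  have hne : ∀ k x, max 0 (1 - |(|f x|) - t k|) ≠ 0 → |(|f x|) - t k| < 1 := by
    intro k x h
    by_contra h'
    exact h (max_eq_left (by linarith))
  have hdisj : ∀ j k, j < k → ∀ x,
      max 0 (1 - |(|f x|) - t j|) = 0 ∨ max 0 (1 - |(|f x|) - t k|) = 0 := by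
    intro j k hjk x
    by_contra! h
    have h1 := abs_lt.1 (hne j x h.1)
    have h2 := abs_lt.1 (hne k x h.2)
    linarith [hsep j k hjk]
  let S : DisjointSystem X :=
    { vec := fun k => Cp.mk _ (hcont k)
      coord := fun k => Cp.eval (p k)
      disjoint := by
        intro j k hjk x
        rcases lt_or_gt_of_ne hjk with h | h
        · exact hdisj j k h x
        · exact (hdisj k j h x).symm
      coord_vec := by
        intro j k
        change max 0 (1 - |t j - t k|) = _
        rcases lt_trichotomy j k with h | h | h
        · rw [if_neg h.ne, max_eq_left]
          have := hsep j k h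
          rw [abs_of_nonpos (by linarith)]
          linarith
        · simp [h]
        · rw [if_neg h.ne', max_eq_left]
          have := hsep k j h
          rw [abs_of_nonneg (by linarith)]
          linarith }
  refine ⟨S, fun a => continuous_finsum
    (fun k => continuous_const.mul (S.vec k).continuous) fun x => ?_⟩
  refine ⟨{y | |f y| < |f x| + 1},
    (isOpen_lt f.continuous.abs continuous_const).mem_nhds (by simp), ?_⟩
  obtain ⟨N, hN⟩ := exists_nat_gt (|f x| + 2)
  refine (Set.finite_lt_nat N).subset ?_
  rintro k ⟨y, hy, hy'⟩
  have h1 := abs_lt.1 (hne k y (right_ne_zero_of_mul hy))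
  have h2 : (k : ℝ) < N := by
    have := hlarge k
    change |f y| < |f x| + 1 at hy'
    linarith
  exact_mod_cast h2

/-- The total variation of a finitely supported signed measure. -/
def totalMass {X : Type*} (μ : X →₀ ℝ) : ℝ := ∑ x ∈ μ.support, |μ x|

lemma abs_sum_le_totalMass {X : Type*} (μ : X →₀ ℝ) (f : X → ℝ) {C : ℝ} (hf : ∀ x, |f x| ≤ C) :
    |μ.sum fun x a => a * f x| ≤ totalMass μ * C := by
  rw [totalMass, Finset.sum_mul]
  refine (Finset.abs_sum_le_sum_abs _ _).trans (Finset.sum_le_sum fun x _ => ?_)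
  rw [abs_mul]
  exact mul_le_mul_of_nonneg_left (hf x) (abs_nonneg _)

lemma totalMass_nonneg {X : Type*} (μ : X →₀ ℝ) : 0 ≤ totalMass μ :=
  Finset.sum_nonneg fun _ _ => abs_nonneg _

/-- On a pseudocompact space, a value `n * (‖ν n‖ + 1)` of the `n`-th functional is too large for
any function to attain for all `n` at once. -/
lemma not_isPseudocompact_of_surjective (ν : ℕ → Cp X →L[ℝ] ℝ)
    (hν : ∀ a : ℕ → ℝ, ∃ g, ∀ n, ν n g = a n) : ¬ IsPseudocompact X := by
  intro hX
  choose μ hμ using fun n => Cp.exists_finsupp (ν n)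
  obtain ⟨g, hg⟩ := hν fun n => n * (totalMass (μ n) + 1)
  obtain ⟨C, hC⟩ := hX g
  obtain ⟨n, hn⟩ := exists_nat_gt (max C 0)
  have h1 := (le_abs_self _).trans (abs_sum_le_totalMass (μ n) g hC)
  rw [← hμ, hg] at h1
  have h2 := totalMass_nonneg (μ n)
  have h3 : (0 : ℝ) < n := (le_max_right _ _).trans_lt hn
  nlinarith [mul_le_mul_of_nonneg_left ((le_max_left _ _).trans_lt hn).le h2]

end Pseudocompact

/-! ### Dependent choice with memory -/

section Recursion

/-- Dependent choice with memory: a sequence may be built by choosing each term in accordance with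
all the terms before it. -/
lemma exists_seq_of_forall_fin {α : Type*} (P : ℕ → α → Prop) (r : ℕ → α → α → Prop)
    (h : ∀ n (g : Fin n → α), (∀ i : Fin n, P i (g i)) →
      ∃ y, P n y ∧ ∀ i : Fin n, r i (g i) y) :
    ∃ f : ℕ → α, (∀ n, P n (f n)) ∧ ∀ m n, m < n → r m (f m) (f n) := by
  obtain ⟨y₀, -⟩ := h 0 Fin.elim0 fun i => i.elim0
  have h' : ∀ n (g : Fin n → α), ∃ y, (∀ i : Fin n, P i (g i)) →
      P n y ∧ ∀ i : Fin n, r i (g i) y := by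
    intro n g
    by_cases hg : ∀ i : Fin n, P i (g i)
    · obtain ⟨y, hy⟩ := h n g hg
      exact ⟨y, fun _ => hy⟩
    · exact ⟨y₀, fun hg' => absurd hg' hg⟩
  choose F hF using h'
  let f : ℕ → α := WellFounded.fix Nat.lt_wfRel.wf fun n g => F n fun i : Fin n => g i i.2
  have hf : ∀ n, f n = F n fun i : Fin n => f i := fun n =>
    WellFounded.fix_eq Nat.lt_wfRel.wf _ n
  have hP : ∀ n, P n (f n) := by
    intro n
    induction n using Nat.strong_induction_on with
    | _ n ih =>
      rw [hf]
      exact (hF n _ fun i => ih i i.2).1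
  refine ⟨f, hP, fun m n hmn => ?_⟩
  rw [hf n]
  exact (hF n (fun i => f i) fun i => hP i).2 ⟨m, hmn⟩

end Recursion

/-! ### Biorthogonalization of triangular systems -/

section Biorthogonalization

variable {E : Type*} [AddCommGroup E] [Module ℝ E] [TopologicalSpace E]

/-- The functionals obtained from a sequence `L` which is unitriangular with respect to the
vectors `v`, by subtracting multiples of the earlier ones so as to become biorthogonal to `v`. -/
noncomputable def triangularDual (L : ℕ → E →L[ℝ] ℝ) (v : ℕ → E) : ℕ → E →L[ℝ] ℝ
  | j => L j - ∑ k : Fin j, L j (v k) • triangularDual L v k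
  decreasing_by exact k.2

variable {L : ℕ → E →L[ℝ] ℝ} {v : ℕ → E}

lemma triangularDual_apply (j : ℕ) (g : E) :
    triangularDual L v j g =
      L j g - ∑ k ∈ Finset.range j, L j (v k) * triangularDual L v k g := by
  rw [triangularDual, Finset.sum_range]
  simp [sum_apply]

lemma triangularDual_vec (h1 : ∀ j, L j (v j) = 1) (h0 : ∀ j k, j < k → L j (v k) = 0)
    (j m : ℕ) : triangularDual L v j (v m) = if j = m then 1 else 0 := by
  induction j using Nat.strong_induction_on with
  | _ j ih =>
    rw [triangularDual_apply, Finset.sum_congr rfl fun k hk => by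
      rw [ih k (Finset.mem_range.1 hk)]]
    simp only [mul_ite, mul_one, mul_zero, Finset.sum_ite_eq', Finset.mem_range]
    rcases lt_trichotomy j m with h | h | h
    · simp [h0 j m h, h.ne, h.not_gt]
    · simp [h, h1]
    · simp [h, h.ne']

/-- If the entries below the diagonal are small, biorthogonalization preserves pointwise
convergence to zero. The functionals stay bounded at each vector because the rows have sum at most
`1 / 2`, and then dominated convergence applies. -/
lemma tendsto_triangularDual
    (hsmall : ∀ j k, k < j → |L j (v k)| ≤ (1 / 4) * (1 / 2 : ℝ) ^ k) (g : E)
    (hg : Tendsto (fun j => L j g) atTop (𝓝 0))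
    (hv : ∀ k, Tendsto (fun j => L j (v k)) atTop (𝓝 0)) :
    Tendsto (fun j => triangularDual L v j g) atTop (𝓝 0) := by
  obtain ⟨M, hM⟩ : ∃ M, ∀ j, |L j g| ≤ M := by
    obtain ⟨M, hM⟩ := (Metric.isBounded_range_of_tendsto _ hg).exists_norm_le
    exact ⟨M, fun j => hM _ ⟨j, rfl⟩⟩
  have hM0 : 0 ≤ M := (abs_nonneg _).trans (hM 0)
  have hbound : ∀ j, |triangularDual L v j g| ≤ 2 * M := by
    intro j
    induction j using Nat.strong_induction_on with
    | _ j ih =>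
      rw [triangularDual_apply]
      have h1 : |∑ k ∈ Finset.range j, L j (v k) * triangularDual L v k g| ≤ M := by
        calc |∑ k ∈ Finset.range j, L j (v k) * triangularDual L v k g|
            ≤ ∑ k ∈ Finset.range j, (1 / 4) * (1 / 2 : ℝ) ^ k * (2 * M) := by
              refine (Finset.abs_sum_le_sum_abs _ _).trans (Finset.sum_le_sum fun k hk => ?_)
              rw [abs_mul]
              have hk' := Finset.mem_range.1 hk
              exact mul_le_mul (hsmall j k hk') (ih k hk') (abs_nonneg _) (by positivity)
          _ = (1 / 2) * M * ∑ k ∈ Finset.range j, (1 / 2 : ℝ) ^ k := by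
              rw [Finset.mul_sum]
              exact Finset.sum_congr rfl fun k _ => by ring
          _ ≤ (1 / 2) * M * 2 :=
              mul_le_mul_of_nonneg_left (sum_geometric_two_le j) (by positivity)
          _ = M := by ring
      linarith [abs_sub (L j g) (∑ k ∈ Finset.range j, L j (v k) * triangularDual L v k g), hM j]
  have hsum : Tendsto (fun j => ∑' k, if k < j then L j (v k) * triangularDual L v k g else 0)
      atTop (𝓝 (∑' _ : ℕ, (0 : ℝ))) := by
    refine tendsto_tsum_of_dominated_convergence
      (bound := fun k => (1 / 4) * (1 / 2 : ℝ) ^ k * (2 * M)) ?_ (fun k => ?_) ?_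
    · exact (summable_geometric_two.mul_left _).mul_right _
    · have := (hv k).mul_const (triangularDual L v k g)
      rw [zero_mul] at this
      exact this.congr' ((eventually_gt_atTop k).mono fun j hj => by simp [hj])
    · refine Eventually.of_forall fun j k => ?_
      split_ifs with hk
      · rw [norm_mul]
        exact mul_le_mul (hsmall j k hk) (hbound k) (norm_nonneg _) (by positivity)
      · rw [norm_zero]
        positivity
  have heq : ∀ j, triangularDual L v j g =
      L j g - ∑' k, if k < j then L j (v k) * triangularDual L v k g else 0 := by
    intro j
    rw [triangularDual_apply, tsum_eq_sum (s := Finset.range j)]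
    · congr 1
      exact Finset.sum_congr rfl fun k hk => by rw [if_pos (Finset.mem_range.1 hk)]
    · intro k hk
      rw [if_neg fun h => hk (Finset.mem_range.2 h)]
  have h := hg.sub hsum
  rw [tsum_zero, sub_zero] at h
  exact h.congr fun j => (heq j).symm

end Biorthogonalization

/-! ### Total variation of finitely supported measures -/

section MassOn

variable {X : Type*}

/-- The total variation on a set of a finitely supported signed measure. -/
noncomputable def massOn (μ : X →₀ ℝ) (V : Set X) : ℝ :=
  ∑ x ∈ μ.support, V.indicator (fun x => |μ x|) x

variable (μ : X →₀ ℝ)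

lemma massOn_nonneg (V : Set X) : 0 ≤ massOn μ V :=
  Finset.sum_nonneg fun _ _ => Set.indicator_nonneg (fun _ _ => abs_nonneg _) _

lemma massOn_le_totalMass (V : Set X) : massOn μ V ≤ totalMass μ :=
  Finset.sum_le_sum fun _ _ => Set.indicator_le_self' (fun _ _ => abs_nonneg _) _

lemma massOn_biUnion_le {ι : Type*} (B : Finset ι) (V : ι → Set X) :
    massOn μ (⋃ i ∈ B, V i) ≤ ∑ i ∈ B, massOn μ (V i) := by
  simp only [massOn]
  rw [Finset.sum_comm]
  refine Finset.sum_le_sum fun x _ => ?_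
  have h0 : ∀ i ∈ B, 0 ≤ (V i).indicator (fun x => |μ x|) x :=
    fun i _ => Set.indicator_nonneg (fun _ _ => abs_nonneg _) _
  by_cases hx : x ∈ ⋃ i ∈ B, V i
  · obtain ⟨i, hi, hxi⟩ := Set.mem_iUnion₂.1 hx
    rw [Set.indicator_of_mem hx]
    refine le_trans ?_ (Finset.single_le_sum h0 hi)
    rw [Set.indicator_of_mem hxi]
  · rw [Set.indicator_of_notMem hx]
    exact Finset.sum_nonneg h0

lemma sum_massOn_le_totalMass {ι : Type*} (B : Finset ι) (V : ι → Set X)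
    (hV : (B : Set ι).PairwiseDisjoint V) : ∑ i ∈ B, massOn μ (V i) ≤ totalMass μ := by
  refine le_trans (le_of_eq ?_) (massOn_le_totalMass μ (⋃ i ∈ B, V i))
  simp only [massOn]
  rw [Finset.sum_comm]
  refine Finset.sum_congr rfl fun x _ => ?_
  rw [Finset.indicator_biUnion B V fun i hi j hj hij => hV hi hj hij]

lemma abs_sum_le_massOn (f : X → ℝ) (V : Set X) (hf : ∀ x, |f x| ≤ 1) (hV : ∀ x ∉ V, f x = 0) :
    |μ.sum fun x a => a * f x| ≤ massOn μ V := by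
  refine (Finset.abs_sum_le_sum_abs _ _).trans (Finset.sum_le_sum fun x _ => ?_)
  by_cases hx : x ∈ V
  · rw [Set.indicator_of_mem hx, abs_mul]
    exact mul_le_of_le_one_right (abs_nonneg _) (hf x)
  · simp [hx, hV x hx]

end MassOn

/-! ### Interpolation on finite sets -/

section Interpolation

variable {X : Type*} [TopologicalSpace X] [T35Space X]

lemma Cp.exists_bump (B : Finset X) {V : Set X} (hV : IsOpen V) (hBV : (B : Set X) ⊆ V) :
    ∃ h : Cp X, (∀ x, 0 ≤ h x ∧ h x ≤ 1) ∧ (∀ x ∈ B, h x = 1) ∧ ∀ x ∉ V, h x = 0 := by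
  have h1 : ∀ y : X, ∃ g : X → ℝ, Continuous g ∧ (∀ x, 0 ≤ g x) ∧
      (y ∈ V → g y = 1) ∧ ∀ x ∉ V, g x = 0 := by
    intro y
    by_cases hy : y ∈ V
    · obtain ⟨f, hf, hf0, hf1⟩ :=
        CompletelyRegularSpace.completely_regular y Vᶜ hV.isClosed_compl (fun h => h hy)
      refine ⟨fun x => 1 - f x, continuous_const.sub (continuous_subtype_val.comp hf),
        fun x => sub_nonneg.2 (f x).2.2, fun _ => by simp [hf0], fun x hx => ?_⟩
      simp [hf1 hx]
    · exact ⟨0, continuous_const, fun _ => le_rfl, fun h => absurd h hy, fun _ _ => rfl⟩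
  choose g hg hg0 hg1 hgV using h1
  refine ⟨Cp.mk (fun x => min 1 (∑ y ∈ B, g y x))
    (continuous_const.min (continuous_finsetSum _ fun y _ => hg y)), fun x => ⟨?_, ?_⟩,
    fun x hx => ?_, fun x hx => ?_⟩
  · exact le_min zero_le_one (Finset.sum_nonneg fun y _ => hg0 y x)
  · exact min_le_left _ _
  · refine min_eq_left ?_
    rw [← hg1 x (hBV hx)]
    exact Finset.single_le_sum (f := fun y => g y x) (fun y _ => hg0 y x) hx
  · simp [hgV _ x hx]

/-- Continuous functions with values in `[-1, 1]` interpolate any values on a finite set. -/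
lemma Cp.exists_interpolation (A : Finset X) (s : X → ℝ) (hs : ∀ x, |s x| ≤ 1) :
    ∃ f : Cp X, (∀ x, |f x| ≤ 1) ∧ ∀ x ∈ A, f x = s x := by
  classical
  have h1 : ∀ y : X, ∃ h : Cp X, h y = 1 ∧ ∀ x ∈ A, x ≠ y → h x = 0 := by
    intro y
    obtain ⟨h, -, hy, h0⟩ := Cp.exists_bump {y} (V := (A.erase y : Set X)ᶜ)
      (A.erase y).finite_toSet.isClosed.isOpen_compl (by simp)
    exact ⟨h, hy y (by simp), fun x hx hxy => h0 x (by simp [hx, hxy])⟩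
  choose h hy h0 using h1
  refine ⟨Cp.mk (fun x => max (-1) (min 1 (∑ y ∈ A, s y * h y x)))
    (continuous_const.max (continuous_const.min
      (continuous_finsetSum _ fun y _ => continuous_const.mul (h y).continuous))),
    fun x => ?_, fun x hx => ?_⟩
  · exact abs_le.2 ⟨le_max_left _ _, max_le (by norm_num) (min_le_left _ _)⟩
  · have h2 : ∑ y ∈ A, s y * h y x = s x := by
      rw [Finset.sum_eq_single_of_mem x hx fun y _ hyx => by rw [h0 y x hx hyx.symm, mul_zero],
        hy, mul_one]
    have h3 := abs_le.1 (hs x)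
    simp only [Cp.mk_apply, h2]
    rw [min_eq_right h3.2, max_eq_right h3.1]

end Interpolation

/-! ### From Josefson–Nissenzweig sequences to disjoint systems -/

section JosefsonNissenzweig

variable {X : Type*} [TopologicalSpace X]

/-- A sequence of finitely supported signed measures of norm one which converges to zero at every
continuous function. -/
structure IsJNSequence (μ : ℕ → X →₀ ℝ) : Prop where
  totalMass_eq_one : ∀ n, totalMass (μ n) = 1
  tendsto : ∀ g : Cp X, Tendsto (fun n => (μ n).sum fun x a => a * g x) atTop (𝓝 0)

variable [T35Space X] {μ : ℕ → X →₀ ℝ}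

/-- At most about half of the mass of a Josefson–Nissenzweig sequence stays on a fixed
finite set: testing against a function that takes on that set the signs of the measure, the mass on
the set has to be compensated by mass off the set. -/
lemma IsJNSequence.eventually_massOn_le (hμ : IsJNSequence μ) (A : Finset X) :
    ∀ᶠ n in atTop, massOn (μ n) A ≤ 9 / 16 := by
  classical
  have h1 : ∀ P : Finset X, ∃ f : Cp X, (∀ x, |f x| ≤ 1) ∧
      ∀ x ∈ A, f x = if x ∈ P then 1 else -1 := fun P =>
    Cp.exists_interpolation A _ fun x => by split_ifs <;> simp
  choose f hf1 hfP using h1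
  have h2 : ∀ P ∈ A.powerset, ∀ᶠ n in atTop, (μ n).sum (fun x a => a * f P x) < 1 / 8 :=
    fun P _ => (hμ.tendsto (f P)).eventually_lt_const (by norm_num)
  filter_upwards [(Filter.eventually_all_finset _).2 h2] with n hn
  set P : Finset X := A.filter fun x => 0 ≤ μ n x
  have h3 := hn P (Finset.mem_powerset.2 (Finset.filter_subset _ _))
  have h4 : 2 * massOn (μ n) A - totalMass (μ n) ≤ (μ n).sum fun x a => a * f P x := by
    rw [massOn, totalMass, Finset.mul_sum, ← Finset.sum_sub_distrib]
    refine Finset.sum_le_sum fun x _ => ?_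
    change _ ≤ μ n x * f P x
    by_cases hx : x ∈ A
    · rw [Set.indicator_of_mem (by exact hx), hfP P x hx]
      by_cases hx0 : 0 ≤ μ n x
      · rw [if_pos (by simp [P, hx, hx0]), abs_of_nonneg hx0]
        linarith
      · rw [if_neg (by simp [P, hx0]), abs_of_neg (not_le.1 hx0)]
        linarith
    · rw [Set.indicator_of_notMem (by exact hx)]
      have h5 : |μ n x * f P x| ≤ |μ n x| := by
        rw [abs_mul]
        exact mul_le_of_le_one_right (abs_nonneg _) (hf1 P x)
      linarith [neg_abs_le (μ n x * f P x)]
  rw [hμ.totalMass_eq_one] at h4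
  linarith

/-- Along an ultrafilter, the masses of neighbourhoods of points shrink to a weight function of
total weight at most one. Off the finite set where most of that weight sits, finite sets have
neighbourhoods of small mass. -/
lemma exists_finset_forall_eventually_massOn_lt (U : Ultrafilter ℕ)
    (hμ : ∀ n, totalMass (μ n) ≤ 1) {ε : ℝ} (hε : 0 < ε) :
    ∃ A : Finset X, ∀ B : Finset X, Disjoint B A →
      ∃ W : Set X, IsOpen W ∧ (B : Set X) ⊆ W ∧ ∀ᶠ n in U, massOn (μ n) W < ε := by
  have h1 : ∀ V : Set X, ∃ m ∈ Set.Icc (0 : ℝ) 1,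
      Tendsto (fun n => massOn (μ n) V) U (𝓝 m) := by
    intro V
    obtain ⟨m, hm, hle⟩ := isCompact_Icc.ultrafilter_le_nhds
      (U.map fun n => massOn (μ n) V) (le_principal_iff.2 (Eventually.of_forall fun n =>
        ⟨massOn_nonneg _ _, (massOn_le_totalMass _ _).trans (hμ n)⟩ :
          ∀ᶠ n in (U : Filter ℕ), massOn (μ n) V ∈ Set.Icc (0 : ℝ) 1))
    exact ⟨m, hm, hle⟩
  choose m hm hmt using h1
  let N : X → Set ℝ := fun x => {r | ∃ V, IsOpen V ∧ x ∈ V ∧ m V = r}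
  have hNne : ∀ x, (N x).Nonempty := fun x => ⟨_, Set.univ, isOpen_univ, Set.mem_univ x, rfl⟩
  have hNbdd : ∀ x, BddBelow (N x) := fun x => ⟨0, by rintro _ ⟨V, -, -, rfl⟩; exact (hm V).1⟩
  let w : X → ℝ := fun x => sInf (N x)
  have hw0 : ∀ x, 0 ≤ w x := fun x =>
    le_csInf (hNne x) (by rintro _ ⟨V, -, -, rfl⟩; exact (hm V).1)
  have hwsum : ∀ B : Finset X, ∑ x ∈ B, w x ≤ 1 := by
    intro B
    obtain ⟨V, hV, hVd⟩ := B.finite_toSet.t2_separation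
    calc ∑ x ∈ B, w x ≤ ∑ x ∈ B, m (V x) := Finset.sum_le_sum fun x _ =>
          csInf_le (hNbdd x) ⟨V x, (hV x).2, (hV x).1, rfl⟩
      _ ≤ 1 := by
          refine le_of_tendsto (tendsto_finsetSum B fun x _ => hmt (V x)) ?_
          exact Eventually.of_forall fun n => (sum_massOn_le_totalMass _ B V hVd).trans (hμ n)
  have hws : Summable w := summable_of_sum_le hw0 hwsum
  obtain ⟨A, hA⟩ := summable_iff_vanishing_norm.1 hws (ε / 2) (half_pos hε)
  refine ⟨A, fun B hB => ?_⟩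
  have hB1 : ∑ x ∈ B, w x < ε / 2 := (le_abs_self _).trans_lt (hA B hB)
  have hc : 0 < ε / 2 / (B.card + 1) := by positivity
  have h2 : ∀ x, ∃ V, IsOpen V ∧ x ∈ V ∧ m V < w x + ε / 2 / (B.card + 1) := by
    intro x
    obtain ⟨_, ⟨V, hV, hxV, rfl⟩, hlt⟩ :=
      exists_lt_of_csInf_lt (hNne x) (lt_add_of_pos_right (w x) hc)
    exact ⟨V, hV, hxV, hlt⟩
  choose V hVo hxV hVm using h2
  refine ⟨⋃ x ∈ B, V x, isOpen_biUnion fun x _ => hVo x,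
    fun x hx => Set.mem_biUnion hx (hxV x), ?_⟩
  have h3 : ∑ x ∈ B, m (V x) < ε := by
    calc ∑ x ∈ B, m (V x) ≤ ∑ x ∈ B, (w x + ε / 2 / (B.card + 1)) :=
          Finset.sum_le_sum fun x _ => (hVm x).le
      _ = ∑ x ∈ B, w x + B.card * (ε / 2 / (B.card + 1)) := by
          rw [Finset.sum_add_distrib, Finset.sum_const, nsmul_eq_mul]
      _ ≤ ∑ x ∈ B, w x + ε / 2 := by
          gcongr
          rw [mul_div_assoc', div_le_iff₀ (by positivity)]
          nlinarith
      _ < ε := by linarith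
  filter_upwards [(tendsto_finsetSum B fun x _ => hmt (V x)).eventually_lt_const h3] with n hn
  exact (massOn_biUnion_le _ _ _).trans_lt hn

/-- A function `f` supported in a closed set `C` with an open neighbourhood `W`, together with the
index of the measure which is to be tested by `f`. -/
structure Block (X : Type*) [TopologicalSpace X] where
  /-- the index of the measure -/
  idx : ℕ
  /-- an open neighbourhood of the support -/
  W : Set X
  /-- a closed set containing the support -/
  C : Set X
  /-- the function -/
  f : Cp X
  isOpen_W : IsOpen W
  isClosed_C : IsClosed C
  subset : C ⊆ W
  apply_eq_zero : ∀ x ∉ C, f x = 0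
  abs_le_one : ∀ x, |f x| ≤ 1

/-- The inductive step in the construction of a disjointly supported sequence of functions that are
seen by the measures: given finitely many blocks whose neighbourhoods have small mass, most of the
mass of some later measure lies off these neighbourhoods, off the supports of the earlier measures
and on a finite set with a neighbourhood of small mass. -/
lemma IsJNSequence.exists_block (hμ : IsJNSequence μ) (U : Ultrafilter ℕ)
    (hU : (U : Filter ℕ) ≤ atTop) {n : ℕ} (b : Fin n → Block X) (ε : ℕ → ℝ) (hε : ∀ k, 0 < ε k)
    (hεsum : ∑ i : Fin n, ε i ≤ 3 / 16)
    (hb : ∀ i : Fin n, ∀ᶠ k in U, massOn (μ k) (b i).W < ε i) :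
    ∃ y : Block X, ((∀ᶠ k in U, massOn (μ k) y.W < ε n) ∧
        1 / 4 ≤ (μ y.idx).sum fun x a => a * y.f x) ∧
      ∀ i : Fin n, (b i).idx < y.idx ∧ (∀ x ∈ (b i).C, y.f x = 0) ∧
        (∀ x ∈ (μ (b i).idx).support, y.f x = 0) ∧ massOn (μ y.idx) (b i).W < ε i := by
  classical
  obtain ⟨A₀, hA₀⟩ := exists_finset_forall_eventually_massOn_lt U
    (fun n => (hμ.totalMass_eq_one n).le) (hε n)
  let A : Finset X := A₀ ∪ Finset.univ.biUnion fun i => (μ (b i).idx).support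
  obtain ⟨k, hkA, hkW, hkidx⟩ :=
    (((hμ.eventually_massOn_le A).filter_mono hU).and ((Filter.eventually_all.2 hb).and
      ((Filter.eventually_all.2 fun i => eventually_gt_atTop (b i).idx).filter_mono hU))).exists
  let B : Finset X := (μ k).support.filter fun x => x ∉ A ∧ ∀ i, x ∉ (b i).W
  have hBA : Disjoint B A :=
    Finset.disjoint_left.2 fun x hx => (Finset.mem_filter.1 hx).2.1
  obtain ⟨W, hWo, hBW, hW⟩ := hA₀ B (hBA.mono_right Finset.subset_union_left)
  -- removing `A` and the old neighbourhoods leaves mass at least `1 - 9 / 16 - 3 / 16 = 1 / 4`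
  have hBmass : 1 / 4 ≤ ∑ x ∈ B, |μ k x| := by
    have h1 : totalMass (μ k) ≤
        massOn (μ k) A + ∑ i, massOn (μ k) (b i).W + ∑ x ∈ B, |μ k x| := by
      simp only [totalMass, massOn]
      rw [Finset.sum_comm, Finset.sum_filter, ← Finset.sum_add_distrib, ← Finset.sum_add_distrib]
      refine Finset.sum_le_sum fun x _ => ?_
      have h0 : ∀ V : Set X, 0 ≤ V.indicator (fun x => |μ k x|) x :=
        fun V => Set.indicator_nonneg (fun _ _ => abs_nonneg _) _
      have h0s : 0 ≤ ∑ i, (b i).W.indicator (fun x => |μ k x|) x :=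
        Finset.sum_nonneg fun i _ => h0 _
      by_cases hxA : x ∈ A
      · rw [Set.indicator_of_mem (s := (A : Set X)) hxA]
        split_ifs <;> linarith [abs_nonneg (μ k x)]
      · by_cases hxW : ∃ i, x ∈ (b i).W
        · obtain ⟨i, hi⟩ := hxW
          have h2 := Finset.single_le_sum (f := fun i => (b i).W.indicator (fun x => |μ k x|) x)
            (fun i _ => h0 _) (Finset.mem_univ i)
          rw [Set.indicator_of_mem hi] at h2
          split_ifs <;> linarith [abs_nonneg (μ k x), h0 A]
        · rw [if_pos ⟨hxA, not_exists.1 hxW⟩]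
          linarith [h0 A]
    have h2 : ∑ i, massOn (μ k) (b i).W ≤ 3 / 16 :=
      (Finset.sum_le_sum fun i _ => (hkW i).le).trans hεsum
    rw [hμ.totalMass_eq_one] at h1
    linarith
  -- the new function lives near `B`, away from the old functions and the other supports
  let V : Set X := W ∩ (⋂ i, (b i).Cᶜ) ∩ (((A ∪ (μ k).support) \ B : Finset X) : Set X)ᶜ
  have hVo : IsOpen V := (hWo.inter (isOpen_iInter_of_finite fun i =>
    (b i).isClosed_C.isOpen_compl)).inter (Finset.finite_toSet _).isClosed.isOpen_compl
  have hBV : (B : Set X) ⊆ V := by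
    intro x hx
    refine ⟨⟨hBW hx, Set.mem_iInter.2 fun i hxi => ?_⟩, fun hx' => ?_⟩
    · exact (Finset.mem_filter.1 hx).2.2 i ((b i).subset hxi)
    · exact (Finset.mem_sdiff.1 hx').2 hx
  obtain ⟨h, h01, hB1, hV0⟩ := Cp.exists_bump B hVo hBV
  obtain ⟨s, hs1, hsB⟩ := Cp.exists_interpolation B (fun x => (SignType.sign (μ k x) : ℝ))
    fun x => by rcases lt_trichotomy (μ k x) 0 with h | h | h <;> simp [h]
  -- the factor `max 0 (2 * h - 1)` vanishes off the closed set `{1 / 2 ≤ h}`, which lies in `V`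
  have hcont : Continuous fun x => s x * max 0 (2 * h x - 1) :=
    s.continuous.mul (continuous_const.max ((continuous_const.mul h.continuous).sub
      continuous_const))
  have hf0 : ∀ x ∉ V, s x * max 0 (2 * h x - 1) = 0 := by
    intro x hx
    rw [hV0 x hx, max_eq_left (by norm_num), mul_zero]
  refine ⟨⟨k, W, {x | 1 / 2 ≤ h x}, Cp.mk _ hcont, hWo,
    isClosed_le continuous_const h.continuous, ?_, ?_, ?_⟩, ⟨hW, ?_⟩, fun i =>
    ⟨hkidx i, ?_, ?_, hkW i⟩⟩
  · intro x hx
    by_contra hxW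
    have h1 := hV0 x fun h => hxW h.1.1
    have h2 : 1 / 2 ≤ h x := hx
    rw [h1] at h2
    norm_num at h2
  · intro x hx
    have hx' : h x < 1 / 2 := not_le.1 hx
    simp only [Cp.mk_apply]
    rw [max_eq_left (by linarith), mul_zero]
  · intro x
    simp only [Cp.mk_apply]
    rw [abs_mul, abs_of_nonneg (le_max_left 0 (2 * h x - 1))]
    exact mul_le_one₀ (hs1 x) (le_max_left _ _) (max_le zero_le_one (by linarith [(h01 x).2]))
  · refine hBmass.trans (le_of_eq ?_)
    simp only [Finsupp.sum, Cp.mk_apply]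
    rw [← Finset.sum_subset (Finset.filter_subset _ _ : B ⊆ (μ k).support)]
    · refine Finset.sum_congr rfl fun x hx => ?_
      rw [hB1 x hx, hsB x hx]
      norm_num [self_mul_sign]
    · intro x hx hxB
      rw [hf0 x fun hxV => hxV.2 ?_, mul_zero]
      exact Finset.mem_coe.2 (Finset.mem_sdiff.2 ⟨Finset.mem_union_right _ hx, hxB⟩)
  · intro x hx
    exact hf0 x fun hxV => Set.mem_iInter.1 hxV.1.2 i hx
  · intro x hx
    refine hf0 x fun hxV => hxV.2 ?_
    have hxA : x ∈ A := Finset.mem_union_right _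
      (Finset.mem_biUnion.2 ⟨i, Finset.mem_univ i, hx⟩)
    exact Finset.mem_coe.2 (Finset.mem_sdiff.2
      ⟨Finset.mem_union_left _ hxA, fun hxB => Finset.disjoint_left.1 hBA hxB hxA⟩)

/-- A Josefson–Nissenzweig sequence yields a bounded disjoint system in `Cp X` with pointwise null
coordinates. -/
lemma IsJNSequence.exists_disjointSystem (hμ : IsJNSequence μ) :
    ∃ S : DisjointSystem X, (∀ k x, |S.vec k x| ≤ 1) ∧
      ∀ g, Tendsto (fun k => S.coord k g) atTop (𝓝 0) := by
  let U : Ultrafilter ℕ := hyperfilter ℕ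
  have hU : (U : Filter ℕ) ≤ atTop := Nat.hyperfilter_le_atTop
  let ε : ℕ → ℝ := fun k => (1 / 16) * (1 / 2) ^ k
  have hε : ∀ k, 0 < ε k := fun k => by positivity
  obtain ⟨b, hb, hbr⟩ := exists_seq_of_forall_fin
    (P := fun n (y : Block X) => (∀ᶠ k in (U : Filter ℕ), massOn (μ k) y.W < ε n) ∧
        1 / 4 ≤ (μ y.idx).sum fun x a => a * y.f x)
    (r := fun i (z y : Block X) => z.idx < y.idx ∧ (∀ x ∈ z.C, y.f x = 0) ∧
        (∀ x ∈ (μ z.idx).support, y.f x = 0) ∧ massOn (μ y.idx) z.W < ε i)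
    (fun n g hg => hμ.exists_block U hU g ε hε (by
      rw [← Finset.sum_range (fun i => ε i), ← Finset.mul_sum]
      linarith [sum_geometric_two_le n]) fun i => (hg i).1)
  have hidx : StrictMono fun k => (b k).idx := fun i j hij => (hbr i j hij).1
  let d : ℕ → ℝ := fun j => (μ (b j).idx).sum fun x a => a * (b j).f x
  have hd : ∀ j, 1 / 4 ≤ d j := fun j => (hb j).2
  have hdinv : ∀ j, 0 < (d j)⁻¹ ∧ (d j)⁻¹ ≤ 4 := by
    intro j
    refine ⟨inv_pos.2 (by linarith [hd j]), ?_⟩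
    rw [inv_le_comm₀ (by linarith [hd j]) (by norm_num)]
    linarith [hd j]
  let L : ℕ → Cp X →L[ℝ] ℝ := fun j => (d j)⁻¹ • Cp.integral (μ (b j).idx)
  have hL : ∀ j g, L j g = (d j)⁻¹ * (μ (b j).idx).sum fun x a => a * g x := fun j g => by
    simp [L, Cp.integral_apply]
  have hLg : ∀ g, Tendsto (fun j => L j g) atTop (𝓝 0) := by
    intro g
    have h1 := ((hμ.tendsto g).comp hidx.tendsto_atTop).abs.const_mul 4
    rw [abs_zero, mul_zero] at h1
    refine squeeze_zero_norm (fun j => ?_) h1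
    rw [hL, Real.norm_eq_abs, abs_mul, abs_of_pos (hdinv j).1]
    exact mul_le_mul_of_nonneg_right (hdinv j).2 (abs_nonneg _)
  let v : ℕ → Cp X := fun k => (b k).f
  have hdiag : ∀ j, L j (v j) = 1 := fun j => by
    rw [hL]
    exact inv_mul_cancel₀ (by linarith [hd j])
  have hupper : ∀ j k, j < k → L j (v k) = 0 := by
    intro j k hjk
    rw [hL, Finsupp.sum, Finset.sum_eq_zero fun x hx => ?_, mul_zero]
    rw [(hbr j k hjk).2.2.1 x hx, mul_zero]
  refine ⟨⟨v, triangularDual L v, ?_, triangularDual_vec hdiag hupper⟩,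
    fun k => (b k).abs_le_one, fun g => tendsto_triangularDual ?_ g (hLg g) fun k => hLg _⟩
  · have key : ∀ j k, j < k → ∀ x, v j x = 0 ∨ v k x = 0 := by
      intro j k hjk x
      by_cases hx : x ∈ (b j).C
      · exact Or.inr ((hbr j k hjk).2.1 x hx)
      · exact Or.inl ((b j).apply_eq_zero x hx)
    intro j k hjk x
    rcases lt_or_gt_of_ne hjk with h | h
    · exact key j k h x
    · exact (key k j h x).symm
  · intro j k hkj
    have h1 : |(μ (b j).idx).sum fun x a => a * v k x| ≤ ε k :=
      (abs_sum_le_massOn _ _ (b k).W (b k).abs_le_one fun x hx =>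
        (b k).apply_eq_zero x fun h => hx ((b k).subset h)).trans (hbr k j hkj).2.2.2.le
    rw [hL, abs_mul, abs_of_pos (hdinv j).1]
    calc _ ≤ 4 * ε k := mul_le_mul (hdinv j).2 h1 (abs_nonneg _) (by norm_num)
      _ = _ := by simp only [ε]; ring

end JosefsonNissenzweig

/-! ### Finding Josefson–Nissenzweig sequences -/

section FindingJNSequences

variable {X : Type*} [TopologicalSpace X]

lemma totalMass_smul {X : Type*} (c : ℝ) (μ : X →₀ ℝ) : totalMass (c • μ) = |c| * totalMass μ := by
  rcases eq_or_ne c 0 with rfl | hc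
  · simp [totalMass]
  · simp [totalMass, Finsupp.support_smul_eq hc, Finset.mul_sum, abs_mul]

lemma totalMass_pos {X : Type*} {μ : X →₀ ℝ} (hμ : μ ≠ 0) : 0 < totalMass μ :=
  Finset.sum_pos (fun _ hx => abs_pos.2 (Finsupp.mem_support_iff.1 hx))
    (Finsupp.support_nonempty_iff.2 hμ)

lemma totalMass_inv_smul {X : Type*} {μ : X →₀ ℝ} (hμ : μ ≠ 0) :
    totalMass ((totalMass μ)⁻¹ • μ) = 1 := by
  have h := totalMass_pos hμ
  rw [totalMass_smul, abs_of_pos (inv_pos.2 h), inv_mul_cancel₀ h.ne']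

lemma sum_smul_finsupp {X : Type*} (c : ℝ) (μ : X →₀ ℝ) (g : X → ℝ) :
    ((c • μ).sum fun x a => a * g x) = c * μ.sum fun x a => a * g x := by
  rw [Finsupp.sum_smul_index fun x => zero_mul _, Finsupp.mul_sum]
  simp only [mul_assoc]

/-- Functionals that map `Cp X` onto the space of null sequences cannot tend to zero in norm when
`X` is pseudocompact, since then the null sequence of the square roots of their norms would not be
attained. Normalizing a subsequence gives a Josefson–Nissenzweig sequence. -/
lemma exists_isJNSequence_of_surjective (hX : IsPseudocompact X) (ν : ℕ → Cp X →L[ℝ] ℝ)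
    (hν : ∀ g, Tendsto (fun n => ν n g) atTop (𝓝 0))
    (hsurj : ∀ a : ℕ → ℝ, Tendsto a atTop (𝓝 0) → ∃ g, ∀ n, ν n g = a n) :
    ∃ μ : ℕ → X →₀ ℝ, IsJNSequence μ := by
  choose μ hμ using fun n => Cp.exists_finsupp (ν n)
  let N : ℕ → ℝ := fun n => totalMass (μ n)
  have hμ0 : ∀ n, μ n ≠ 0 := by
    intro n h0
    obtain ⟨g, hg⟩ := hsurj (fun k => if k = n then 1 else 0)
      (tendsto_const_nhds.congr' ((eventually_gt_atTop n).mono fun k hk => by simp [hk.ne']))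
    have h1 := hμ n g
    rw [hg, h0] at h1
    simp at h1
  have hN : ∀ n, 0 < N n := fun n => totalMass_pos (hμ0 n)
  have hN0 : ¬ Tendsto N atTop (𝓝 0) := by
    intro h
    have hs : Tendsto (fun n => √(N n)) atTop (𝓝 0) := by simpa using h.sqrt
    obtain ⟨g, hg⟩ := hsurj _ hs
    obtain ⟨C, hC⟩ := hX g
    have h1 : ∀ n, 1 ≤ √(N n) * C := by
      intro n
      have h2 := (le_abs_self _).trans (abs_sum_le_totalMass (μ n) g hC)
      rw [← hμ, hg] at h2
      change √(N n) ≤ N n * C at h2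
      have h3 : 0 < √(N n) := Real.sqrt_pos.2 (hN n)
      rw [← Real.mul_self_sqrt (hN n).le, mul_assoc] at h2
      exact le_of_mul_le_mul_left (by simpa using h2) h3
    have h4 := ge_of_tendsto (hs.mul_const C) (Eventually.of_forall h1)
    norm_num at h4
  obtain ⟨δ, hδ, hfreq⟩ : ∃ δ > 0, ∃ᶠ n in atTop, δ ≤ N n := by
    rw [Metric.tendsto_nhds] at hN0
    push Not at hN0
    obtain ⟨δ, hδ, h⟩ := hN0
    refine ⟨δ, hδ, h.mono fun n hn => ?_⟩
    rwa [Real.dist_eq, sub_zero, abs_of_pos (hN n)] at hn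
  obtain ⟨φ, hφ, hφδ⟩ := extraction_of_frequently_atTop hfreq
  refine ⟨fun k => (N (φ k))⁻¹ • μ (φ k), fun k => totalMass_inv_smul (hμ0 _), fun g => ?_⟩
  have h1 := ((hν g).comp hφ.tendsto_atTop).abs.const_mul δ⁻¹
  rw [abs_zero, mul_zero] at h1
  refine squeeze_zero_norm (fun k => ?_) h1
  rw [sum_smul_finsupp, ← hμ, Real.norm_eq_abs, abs_mul, abs_of_pos (inv_pos.2 (hN _))]
  exact mul_le_mul_of_nonneg_right (inv_anti₀ hδ (hφδ k)) (abs_nonneg _)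

/-- A continuous image of a pseudocompact space in a countable product of lines is compact: its
coordinates are bounded, and it is closed since the inverse of the distance to a missing limit
point would be unbounded. -/
lemma IsPseudocompact.isCompact_range (hX : IsPseudocompact X) {ι : Type*} [Countable ι]
    {g : X → ι → ℝ} (hg : Continuous g) : IsCompact (Set.range g) := by
  have hbdd : ∀ i, ∃ C, ∀ x, |g x i| ≤ C := fun i =>
    hX (Cp.mk _ ((continuous_apply i).comp hg))
  choose C hC using hbdd
  have hK : IsCompact (Set.pi Set.univ fun i => Metric.closedBall (0 : ℝ) (C i)) :=
    isCompact_univ_pi fun i => isCompact_closedBall _ _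
  refine hK.of_isClosed_subset ?_ ?_
  · let _ : MetricSpace (ι → ℝ) := TopologicalSpace.metrizableSpaceMetric _
    refine isClosed_of_closure_subset fun p hp => ?_
    by_contra hpK
    have hpos : ∀ x, 0 < dist p (g x) := fun x =>
      dist_pos.2 fun h => hpK ⟨x, h.symm⟩
    obtain ⟨M, hM⟩ := hX (Cp.mk (fun x => (dist p (g x))⁻¹)
      ((continuous_const.dist hg).inv₀ fun x => (hpos x).ne'))
    have hM1 : 0 < max M 1 := lt_max_of_lt_right one_pos
    obtain ⟨_, ⟨x, rfl⟩, hx⟩ := Metric.mem_closure_iff.1 hp _ (inv_pos.2 hM1)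
    have h1 := (le_abs_self _).trans (hM x)
    have h2 := (lt_inv_comm₀ (hpos x) hM1).1 hx
    exact absurd (h1.trans (le_max_left M 1)) h2.not_ge
  · rintro _ ⟨x, rfl⟩ i -
    simpa using hC i x

/-- If countably many members of a subspace of `Cp X` separate the same points as the whole
subspace and `X` is pseudocompact, then the subspace lives on a compact metrizable quotient of `X`,
hence is separable for the supremum norm. -/
lemma IsPseudocompact.exists_uniformly_dense_seq (hX : IsPseudocompact X)
    (F : Submodule ℝ (Cp X)) (D : Set F) (hD : D.Countable)
    (hsep : ∀ x y, (∀ d ∈ D, (d : Cp X) x = (d : Cp X) y) →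
      ∀ f : F, (f : Cp X) x = (f : Cp X) y) :
    ∃ h : ℕ → F, ∀ f : F, ∀ ε > 0, ∃ i, ∀ x, |(f : Cp X) x - (h i : Cp X) x| ≤ ε := by
  have : Countable D := hD.to_subtype
  let g : X → D → ℝ := fun x d => (d : Cp X) x
  have hg : Continuous g := continuous_pi fun d => (d : Cp X).continuous
  let K := Set.range g
  have hK : CompactSpace K := isCompact_iff_compactSpace.1 (hX.isCompact_range hg)
  have hfac : ∀ f : F, ∃ φ : C(K, ℝ), ∀ x, φ ⟨g x, x, rfl⟩ = (f : Cp X) x := by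
    intro f
    let G : X → Option D → ℝ := fun x o => o.elim ((f : Cp X) x) (g x)
    have hG : Continuous G := by
      refine continuous_pi fun o => ?_
      cases o with
      | none => exact (f : Cp X).continuous
      | some d => exact (d : Cp X).continuous
    have hKG : CompactSpace (Set.range G) := isCompact_iff_compactSpace.1 (hX.isCompact_range hG)
    let π : Set.range G → K := fun p => ⟨fun d => p.1 (some d), by
      obtain ⟨_, x, rfl⟩ := p
      exact ⟨x, rfl⟩⟩
    have hπ : Continuous π := by
      refine Continuous.subtype_mk (continuous_pi fun d => ?_) _
      exact (continuous_apply (some d)).comp continuous_subtype_val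
    have hπs : Function.Surjective π := by
      rintro ⟨_, x, rfl⟩
      exact ⟨⟨G x, x, rfl⟩, rfl⟩
    -- a continuous surjection of compact Hausdorff spaces is a quotient map
    have hq : IsQuotientMap π := hπ.isClosedMap.isQuotientMap hπ hπs
    let φ : K → ℝ := fun p => (f : Cp X) p.2.choose
    have hφ : ∀ x, φ ⟨g x, x, rfl⟩ = (f : Cp X) x := by
      intro x
      change (f : Cp X) (⟨g x, x, rfl⟩ : K).2.choose = _
      refine hsep _ _ (fun d hd => ?_) f
      exact congrFun (⟨g x, x, rfl⟩ : K).2.choose_spec ⟨d, hd⟩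
    refine ⟨⟨φ, hq.continuous_iff.2 ?_⟩, hφ⟩
    have h1 : φ ∘ π = fun p => p.1 none := by
      funext p
      obtain ⟨_, x, rfl⟩ := p
      exact hφ x
    rw [h1]
    exact (continuous_apply none).comp continuous_subtype_val
  choose Φ hΦ using hfac
  have : Nonempty (Set.range Φ) := ⟨⟨Φ 0, 0, rfl⟩⟩
  choose h hh using fun i => (TopologicalSpace.denseSeq (Set.range Φ) i).2
  refine ⟨h, fun f ε hε => ?_⟩
  obtain ⟨i, hi⟩ := (TopologicalSpace.denseRange_denseSeq (Set.range Φ)).exists_dist_lt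
    ⟨Φ f, f, rfl⟩ hε
  refine ⟨i, fun x => ?_⟩
  rw [← hΦ, ← hΦ, ← Real.dist_eq, hh]
  exact (ContinuousMap.dist_apply_le_dist _).trans hi.le

/-- A finite-dimensional space of functionals is separated by finitely many vectors. -/
lemma exists_finite_separating_dual {V E : Type*} [AddCommGroup V] [Module ℝ V] [AddCommGroup E]
    [Module ℝ E] [FiniteDimensional ℝ E] (T : V →ₗ[ℝ] Module.Dual ℝ E) :
    ∃ s : Set V, s.Finite ∧ ∀ L : E, (∀ d ∈ s, T d L = 0) → ∀ f, T f L = 0 := by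
  obtain ⟨b, hb, hspan, -⟩ := Submodule.exists_fun_fin_finrank_span_eq ℝ (Set.range T)
  choose d hd using hb
  refine ⟨Set.range d, Set.finite_range d, fun L h0 f => ?_⟩
  have h1 : T f ∈ Submodule.span ℝ (Set.range b) := by
    rw [hspan]
    exact Submodule.subset_span ⟨f, rfl⟩
  have h2 : Submodule.span ℝ (Set.range b) ≤ LinearMap.ker (Module.Dual.eval ℝ E L) := by
    rw [Submodule.span_le]
    rintro _ ⟨i, rfl⟩
    rw [← hd i]
    exact h0 _ ⟨i, rfl⟩
  exact h2 h1

/-- A space whose dual has countable dimension contains countably many vectors that separate its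
dual. -/
lemma exists_countable_separating_dual {F : Type*} [AddCommGroup F] [Module ℝ F]
    [TopologicalSpace F] (e : (F →L[ℝ] ℝ) ≃ₗ[ℝ] (ℕ →₀ ℝ)) :
    ∃ D : Set F, D.Countable ∧ ∀ L : F →L[ℝ] ℝ, (∀ d ∈ D, L d = 0) → L = 0 := by
  let E : ℕ → Submodule ℝ (F →L[ℝ] ℝ) := fun n =>
    Submodule.span ℝ ((fun k => e.symm (Finsupp.single k 1)) '' Set.Iio n)
  have hfin : ∀ n, FiniteDimensional ℝ (E n) := fun n =>
    FiniteDimensional.span_of_finite ℝ ((Set.finite_Iio n).image _)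
  let T : ∀ n, F →ₗ[ℝ] Module.Dual ℝ (E n) := fun n =>
    { toFun := fun f =>
        { toFun := fun L => (L : F →L[ℝ] ℝ) f
          map_add' := fun _ _ => rfl
          map_smul' := fun _ _ => rfl }
      map_add' := fun f g => LinearMap.ext fun L => map_add (L : F →L[ℝ] ℝ) f g
      map_smul' := fun c f => LinearMap.ext fun L => map_smul (L : F →L[ℝ] ℝ) c f }
  choose s hs hsE using fun n => exists_finite_separating_dual (E := E n) (T n)
  refine ⟨⋃ n, s n, Set.countable_iUnion fun n => (hs n).countable, fun L hL => ?_⟩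
  obtain ⟨n, hn⟩ := (e L).support.bddAbove
  have h1 : L = ∑ k ∈ (e L).support, (e L k) • e.symm (Finsupp.single k 1) := by
    apply e.injective
    simp only [map_sum, map_smul, LinearEquiv.apply_symm_apply]
    conv_lhs => rw [← Finsupp.sum_single (e L)]
    simp [Finsupp.sum]
  have h2 : L ∈ E (n + 1) := by
    rw [h1]
    refine Submodule.sum_mem _ fun k hk => Submodule.smul_mem _ _ (Submodule.subset_span ?_)
    exact ⟨k, Nat.lt_succ_of_le (hn hk), rfl⟩
  ext f
  exact hsE (n + 1) ⟨L, h2⟩ (fun d hd => hL d (Set.mem_iUnion.2 ⟨_, hd⟩)) f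

/-- A complemented subspace `F` with strong dual `φ` gives a Josefson–Nissenzweig sequence if `X` is
pseudocompact: `F` is separable for the supremum norm, and the dual of `F`, being infinite
dimensional, contains functionals that vanish on more and more members of a dense sequence and
whose compositions with the projection onto `F` have norm one. -/
lemma exists_isJNSequence_of_isPhiDual (hX : IsPseudocompact X) {F : Submodule ℝ (Cp X)}
    (hF : F.ClosedComplemented) (hφ : IsPhiDual F) : ∃ μ : ℕ → X →₀ ℝ, IsJNSequence μ := by
  obtain ⟨P, hP⟩ := hF
  obtain ⟨Θ⟩ := hφ
  let e : (F →L[ℝ] ℝ) ≃ₗ[ℝ] (ℕ →₀ ℝ) := Θ.toLinearEquiv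
  obtain ⟨D, hD, hDsep⟩ := exists_countable_separating_dual e
  obtain ⟨h, hh⟩ := hX.exists_uniformly_dense_seq F D hD (by
    intro x y hxy f
    have h1 := hDsep ((Cp.eval x - Cp.eval y).comp F.subtypeL) fun d hd => by
      simpa [sub_eq_zero] using hxy d hd
    have h2 := DFunLike.congr_fun h1 f
    simpa [sub_eq_zero] using h2)
  have hker : ∀ n, ∃ L : F →L[ℝ] ℝ, L ≠ 0 ∧ ∀ i < n, L (h i) = 0 := by
    intro n
    let R : (F →L[ℝ] ℝ) →ₗ[ℝ] Fin n → ℝ :=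
      { toFun := fun L i => L (h i)
        map_add' := fun _ _ => rfl
        map_smul' := fun _ _ => rfl }
    by_contra! hcon
    have hinj : Function.Injective R := by
      rw [← LinearMap.ker_eq_bot, LinearMap.ker_eq_bot']
      intro L hL
      by_contra hL0
      obtain ⟨i, hi, hne⟩ := hcon L hL0
      exact hne (congrFun hL ⟨i, hi⟩)
    have h1 : Module.Finite ℝ (F →L[ℝ] ℝ) := Module.Finite.of_injective R hinj
    have h2 : Module.Finite ℝ (ℕ →₀ ℝ) := Module.Finite.equiv e
    have h3 : Finite ℕ := Module.Finite.finite_basis (Finsupp.basisSingleOne (R := ℝ) (ι := ℕ))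
    exact not_finite ℕ
  choose L hL0 hLh using hker
  choose μ hμ using fun n => Cp.exists_finsupp ((L n).comp P)
  have hμ0 : ∀ n, μ n ≠ 0 := by
    intro n hn
    refine hL0 n (ContinuousLinearMap.ext fun f => ?_)
    have h1 := hμ n f
    rw [hn, ContinuousLinearMap.comp_apply, hP] at h1
    simpa using h1
  refine ⟨fun n => (totalMass (μ n))⁻¹ • μ n, fun n => totalMass_inv_smul (hμ0 n), fun g => ?_⟩
  rw [Metric.tendsto_atTop]
  intro ε hε
  obtain ⟨i, hi⟩ := hh (P g) (ε / 2) (half_pos hε)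
  refine ⟨i + 1, fun n hn => ?_⟩
  have h1 : L n (P g) = L n (P ((P g - h i : F) : Cp X)) := by
    rw [hP, map_sub, hLh n i (by omega), sub_zero]
  have h2 := abs_sum_le_totalMass (μ n) ((P g - h i : F) : Cp X) hi
  have h3 : (μ n).sum (fun x a => a * g x) =
      (μ n).sum fun x a => a * ((P g - h i : F) : Cp X) x := by
    rw [← hμ, ← hμ]
    exact h1
  have hpos := totalMass_pos (hμ0 n)
  rw [sum_smul_finsupp, h3, Real.dist_eq, sub_zero, abs_mul, abs_of_pos (inv_pos.2 hpos)]
  calc _ ≤ (totalMass (μ n))⁻¹ * (totalMass (μ n) * (ε / 2)) :=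
        mul_le_mul_of_nonneg_left h2 (inv_pos.2 hpos).le
    _ = ε / 2 := inv_mul_cancel_left₀ hpos.ne' _
    _ < ε := half_lt_self hε

end FindingJNSequences

end

theorem theorem2p7 {X : Type*} [TopologicalSpace X] [T35Space X] :
    (∃ F : Submodule ℝ (Cp X), F.ClosedComplemented ∧ IsPhiDual F) ↔
      (IsContinuousLinearImage (Cp (Set.Icc (1 : Ordinal.{0}) Ordinal.omega0)) (Cp X) ∨
        IsContinuousLinearImage (Cp ℕ) (Cp X)) := by
  by_cases hX : IsPseudocompact X
  · constructor
    · rintro ⟨F, hF, hφ⟩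
      obtain ⟨μ, hμ⟩ := exists_isJNSequence_of_isPhiDual hX hF hφ
      obtain ⟨S, hS1, hS0⟩ := hμ.exists_disjointSystem
      exact Or.inl (isContinuousLinearImage_cp_omegaIcc_iff.2 ⟨S.coord, hS0, fun a ha =>
        ⟨_, S.coord_finsum a (S.continuous_finsum_of_tendsto hS1 ha)⟩⟩)
    · rintro (h | h)
      · obtain ⟨ν, hν, hsurj⟩ := isContinuousLinearImage_cp_omegaIcc_iff.1 h
        obtain ⟨μ, hμ⟩ := exists_isJNSequence_of_surjective hX ν hν hsurj
        obtain ⟨S, hS1, hS0⟩ := hμ.exists_disjointSystem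
        exact S.exists_closedComplemented_isPhiDual fun g =>
          S.continuous_finsum_of_tendsto hS1 (hS0 g)
      · obtain ⟨ν, hν⟩ := isContinuousLinearImage_cp_nat_iff.1 h
        exact absurd hX (not_isPseudocompact_of_surjective ν hν)
  · -- both assertions hold
    obtain ⟨S, hS⟩ := exists_disjointSystem_of_not_isPseudocompact hX
    exact ⟨fun _ => Or.inr (isContinuousLinearImage_cp_nat_iff.2
      ⟨S.coord, fun a => ⟨_, S.coord_finsum a (hS a)⟩⟩),
      fun _ => S.exists_closedComplemented_isPhiDual fun g => hS _⟩
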